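/- Let $G=(V,E)$ be a finite, connected, simple undirected graph, and let $s\neq t$ be vertices of $G$ such that $\{s,t\}\notin E$. Let $\overrightarrow{E}=\{(u,v):\{u,v\}\in E\}$ be the set of directed edges of $G$. A unit $st$-flow on $G$ is a function $\theta:\overrightarrow{E}\to\mathbb{R}$ such that $\theta(u,v)=-\theta(v,u)$ for all $(u,v)\in\overrightarrow{E}$; $\sum_{v:(s,v)\in\overrightarrow{E}}\theta(s,v)=\sum_{v:(v,t)\in\overrightarrow{E}}\theta(v,t)=1$; and $\sum_{v:(u,v)\in\overrightarrow{E}}\theta(u,v)=0$ for all $u\in V\setminus\{s,t\}$. Its energy is $J(\theta)=\frac12\sum_{e\in\overrightarrow{E}}\theta(e)^2$, and $R_{s,t}(G)=\min_\theta J(\theta)$, the minimum over all unit $st$-flows, is the effective resistance between $s$ and $t$. Let $\mathcal{T}_H$ denote the set of spanning trees of a (multi)graph $H$ (in a multigraph, spanning trees with different edge sets are different, even if they differ only by parallel edges), and for $\{u,v\}\in E$ let $\mathcal{N}_G(u,v)$ be the set of spanning trees of $G$ whose unique path from $s$ to $t$ traverses $\{u,v\}$ in the direction from $u$ to $v$.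 Let $\overline{G}$ be $G$ with the additional edge $\{s,t\}$, and let $\overline{G}/\{s,t\}$ be the multigraph obtained from $\overline{G}$ by contracting this edge; that is, $G$ with $s$ and $t$ identified, where parallel edges that arise are kept. Then there is exactly one unit $st$-flow $\theta$ on $G$ of minimum energy, and for every edge $\{u,v\}\in E$ the quantity $q_{u,v}:=\theta(u,v)^2/R_{s,t}(G)$ satisfies $$q_{u,v}=\frac{\bigl(|\mathcal{N}_G(u,v)|-|\mathcal{N}_G(v,u)|\bigr)^2}{|\mathcal{T}_G|\cdot|\mathcal{T}_{\overline{G}/\{s,t\}}|}.$$ -/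

import Mathlib

open scoped ENNReal

/-! ### Multigraphs: spanning trees and edge contraction -/

/-- A multigraph is a tree if it is connected and has no cycles. A loop is a cycle of length 1 and
a pair of parallel edges is a cycle of length 2, so this says that it has no loops and no parallel
edges, and that the simple graph it then amounts to is a tree. -/
def Graph.IsTree {α β : Type*} (T : Graph α β) : Prop :=
  T.Simple ∧ T.toSimpleGraph.IsTree

/-- The set of spanning trees of a multigraph. Two spanning trees with different sets of edges are
different, even if the edges are parallel. -/
def Graph.spanningTrees {α β : Type*} (H : Graph α β) : Set (Graph α β) :=
  {T | T.IsSpanningSubgraph H ∧ T.IsTree}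

open Classical in
/-- The contraction `H / e` of an edge `e` with ends `x` and `y`: the edge `e` is removed and `y` is
identified with `x`. All other edges are kept, so parallel edges can arise. -/
noncomputable def Graph.contractEdge {α β : Type*} (H : Graph α β) (e : β) (x y : α)
    (_he : H.IsLink e x y) : Graph α β :=
  (H.deleteEdges {e}).map (fun z => if z = y then x else z)

namespace SimpleGraph

/-- The graph `G` with an additional edge between `s` and `t`. -/
def addEdge {V : Type*} (G : SimpleGraph V) (s t : V) : SimpleGraph V :=
  G ⊔ SimpleGraph.edge s t

theorem addEdge_isLink {V : Type*} (G : SimpleGraph V) {s t : V} (hst : s ≠ t) :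
    (Graph.ofSimpleGraph (G.addEdge s t)).IsLink s(s, t) s t := by
  simp [Graph.ofSimpleGraph, addEdge, hst]

/-- The multigraph obtained by adding the edge `{s, t}` to `G` and then contracting it. -/
noncomputable def addEdgeContract {V : Type*} (G : SimpleGraph V) {s t : V} (hst : s ≠ t) :
    Graph V (Sym2 V) :=
  (Graph.ofSimpleGraph (G.addEdge s t)).contractEdge s(s, t) s t (G.addEdge_isLink hst)

/-- The set of spanning trees of `G`. -/
def spanningTrees {V : Type*} (G : SimpleGraph V) : Set (SimpleGraph V) :=
  {T | T ≤ G ∧ T.IsTree}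

/-- The set of spanning trees of `G` whose (unique) path from `s` to `t` traverses the edge
`{u, v}` in the direction from `u` to `v`. -/
def spanningTreesThrough {V : Type*} (G : SimpleGraph V) (s t u v : V) : Set (SimpleGraph V) :=
  {T | T ∈ G.spanningTrees ∧
    ∃ p : T.Walk s t, p.IsPath ∧ ∃ d ∈ p.darts, d.toProd = (u, v)}

/-! ### Flows -/

/-- A unit `st`-flow, as a function on the directed edges of `G`. -/
structure IsUnitFlow {V : Type*} [Fintype V] [DecidableEq V] (G : SimpleGraph V)
    [DecidableRel G.Adj] (s t : V) (θ : G.Dart → ℝ) : Prop where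
  antisymm : ∀ d : G.Dart, θ d = -θ d.symm
  source : ∑ d : G.Dart with d.fst = s, θ d = 1
  sink : ∑ d : G.Dart with d.snd = t, θ d = 1
  conserve : ∀ u : V, u ≠ s → u ≠ t → ∑ d : G.Dart with d.fst = u, θ d = 0

/-- The energy of a flow: half the sum of the squares over all directed edges. -/
noncomputable def flowEnergy {V : Type*} [Fintype V] (G : SimpleGraph V)
    [DecidableRel G.Adj] (θ : G.Dart → ℝ) : ℝ :=
  (1 / 2) * ∑ d : G.Dart, θ d ^ 2

/-- A unit `st`-flow of minimum energy. -/
def IsOptimalFlow {V : Type*} [Fintype V] [DecidableEq V] (G : SimpleGraph V)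
    [DecidableRel G.Adj] (s t : V) (θ : G.Dart → ℝ) : Prop :=
  G.IsUnitFlow s t θ ∧ ∀ θ' : G.Dart → ℝ, G.IsUnitFlow s t θ' → G.flowEnergy θ ≤ G.flowEnergy θ'

open Classical in
/-- The effective resistance of `G` between `s` and `t`: the minimum energy of a unit `st`-flow,
and `∞` if `s` and `t` are not connected. -/
noncomputable def effectiveResistance {V : Type*} [Fintype V] [DecidableEq V] (G : SimpleGraph V)
    [DecidableRel G.Adj] (s t : V) : ℝ≥0∞ :=
  if G.Reachable s t then
    ⨅ (θ : G.Dart → ℝ) (_ : G.IsUnitFlow s t θ), ENNReal.ofReal (G.flowEnergy θ)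
  else ⊤

/-- The quantity `θ(d)² / R_{s,t}(G)`. -/
noncomputable def edgeProb {V : Type*} [Fintype V] [DecidableEq V] (G : SimpleGraph V)
    [DecidableRel G.Adj] (s t : V) (θ : G.Dart → ℝ) (d : G.Dart) : ℝ :=
  θ d ^ 2 / (G.effectiveResistance s t).toReal

end SimpleGraph

/-! The optimal flow is Kirchhoff's: send a unit along the `s`-`t` path of each spanning tree and
average over all trees, so `θ(u,v) = (|N(u,v)| - |N(v,u)|) / |T_G|`. An average of unit flows is a
unit flow (`isUnitFlow_of_spanningTrees`). It is also a gradient. Deleting `uv` from a tree counted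
by `N(u,v)` leaves a two-component forest with `u` on the side of `s` and `v` on the side of `t`.
Hence `θ(u,v) = φ(u) - φ(v)`, where `φ(u)` is the number of `separatingForests` with `u` on the side
of `s`, divided by `|T_G|` (`ncard_spanningTreesThrough_sub`). A gradient unit flow is the unique
minimiser, and its energy is `φ(s) - φ(t)`, the number of separating forests over `|T_G|`.
Identifying `s` with `t` turns these forests into the spanning trees of the contraction
(`ncard_spanningTrees_addEdgeContract`). -/

namespace SimpleGraph

/-! ### Spanning trees and two-component forests -/

variable {V : Type*}

theorem Walk.mem_of_forall_adj {G : SimpleGraph V} {S : Set V}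
    (hS : ∀ x y, G.Adj x y → x ∈ S → y ∈ S) {a b : V} (p : G.Walk a b) (ha : a ∈ S) : b ∈ S := by
  by_contra hb
  obtain ⟨d, -, h1, h2⟩ := p.exists_boundary_dart S ha hb
  exact h2 (hS _ _ d.adj h1)

/-- Adding the edge `{a, b}` to `F` makes it connected iff every vertex is joined in `F` to `a` or
to `b`. -/
theorem connected_sup_edge_iff (F : SimpleGraph V) {a b : V} (hab : a ≠ b) :
    (F ⊔ edge a b).Connected ↔ ∀ w, F.Reachable a w ∨ F.Reachable b w := by
  have hadj : (F ⊔ edge a b).Adj a b := by simp [hab, edge_adj]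
  constructor
  · intro h w
    obtain ⟨p⟩ := h.preconnected a w
    refine p.mem_of_forall_adj (S := {w | F.Reachable a w ∨ F.Reachable b w}) ?_
      (Or.inl (Reachable.refl a))
    rintro x y hxy hx
    rw [sup_adj, edge_adj] at hxy
    rcases hxy with hxy | ⟨⟨rfl, rfl⟩ | ⟨rfl, rfl⟩, -⟩
    · exact hx.imp (·.trans hxy.reachable) (·.trans hxy.reachable)
    · exact Or.inr (Reachable.refl _)
    · exact Or.inl (Reachable.refl _)
  · intro h
    have key : ∀ w, (F ⊔ edge a b).Reachable a w := fun w ↦ (h w).elim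
      (fun h ↦ h.mono le_sup_left) (fun h ↦ hadj.reachable.trans (h.mono le_sup_left))
    have : Nonempty V := ⟨a⟩
    exact ⟨fun x y ↦ (key x).symm.trans (key y)⟩

theorem isTree_sup_edge_iff (F : SimpleGraph V) {a b : V} (hab : a ≠ b) (hadj : ¬ F.Adj a b) :
    (F ⊔ edge a b).IsTree ↔ F.IsAcyclic ∧ ¬ F.Reachable a b ∧
      ∀ w, F.Reachable a w ∨ F.Reachable b w := by
  rw [isTree_iff, connected_sup_edge_iff F hab, isAcyclic_sup_fromEdgeSet_iff]
  tauto

/-- The spanning forests of `G` with exactly two components, one containing `s` and the other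
containing `t`. -/
def separatingForests (G : SimpleGraph V) (s t : V) : Set (SimpleGraph V) :=
  {F | F ≤ G ∧ F.IsAcyclic ∧ ¬ F.Reachable s t ∧ ∀ w, F.Reachable s w ∨ F.Reachable t w}

/-- A trail uses the edge of `d` only once, so its segments before and after `d` survive the
deletion. -/
theorem Walk.IsTrail.reachable_deleteEdges {G : SimpleGraph V} {a b : V} {p : G.Walk a b}
    (hp : p.IsTrail) {d : G.Dart} (hd : d ∈ p.darts) :
    (G.deleteEdges {d.edge}).Reachable a d.fst ∧ (G.deleteEdges {d.edge}).Reachable d.snd b := by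
  induction p with
  | nil => simp at hd
  | @cons a c b h p ih =>
    rw [Walk.isTrail_cons] at hp
    rw [Walk.darts_cons, List.mem_cons] at hd
    rcases hd with rfl | hd
    · refine ⟨Reachable.refl _, ?_⟩
      exact reachable_deleteEdges_iff_exists_walk.2 ⟨p, hp.2⟩
    · obtain ⟨h1, h2⟩ := ih hp.1 hd
      refine ⟨Reachable.trans (Adj.reachable ?_) h1, h2⟩
      rw [deleteEdges_adj]
      refine ⟨h, fun he ↦ hp.2 ?_⟩
      rw [Set.mem_singleton_iff.1 he]
      exact List.mem_map_of_mem hd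

theorem deleteEdges_sup_edge {T : SimpleGraph V} {u v : V} (h : T.Adj u v) :
    T.deleteEdges {s(u, v)} ⊔ edge u v = T := by
  ext x y
  have := h.ne
  simp only [sup_adj, deleteEdges_adj, edge_adj, Set.mem_singleton_iff, Sym2.eq_iff]
  grind [h.symm]

theorem sup_edge_deleteEdges {F : SimpleGraph V} {u v : V} (h : ¬ F.Adj u v) :
    (F ⊔ edge u v).deleteEdges {s(u, v)} = F := by
  ext x y
  have h' : ¬ F.Adj v u := fun h' ↦ h h'.symm
  simp only [sup_adj, deleteEdges_adj, edge_adj, Set.mem_singleton_iff, Sym2.eq_iff]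
  grind

theorem ncard_spanningTreesThrough (G : SimpleGraph V) {s t u v : V} (huv : G.Adj u v) :
    (G.spanningTreesThrough s t u v).ncard =
      {F ∈ G.separatingForests s t | F.Reachable s u ∧ F.Reachable t v}.ncard := by
  have hadj : ∀ T ∈ G.spanningTreesThrough s t u v, T.Adj u v := by
    rintro T ⟨-, p, -, ⟨⟨a, b⟩, hd⟩, -, h⟩
    cases h
    exact hd
  refine Set.ncard_congr (fun T _ ↦ T.deleteEdges {s(u, v)}) ?_ ?_ ?_
  · intro T hT
    have hTuv := hadj T hT
    obtain ⟨⟨hTG, hT⟩, p, hp, d, hd, hduv⟩ := hT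
    have hr := hp.isTrail.reachable_deleteEdges hd
    have he : d.edge = s(u, v) := by
      rcases d with ⟨⟨a, b⟩, hab⟩
      cases hduv
      rfl
    rw [he, show d.fst = u from congrArg Prod.fst hduv,
      show d.snd = v from congrArg Prod.snd hduv] at hr
    rw [← deleteEdges_sup_edge hTuv, isTree_sup_edge_iff _ hTuv.ne (by simp)] at hT
    obtain ⟨h1, h2, h3⟩ := hT
    refine ⟨⟨(deleteEdges_le _).trans hTG, h1, fun h ↦ h2 ?_, fun w ↦ ?_⟩, hr.1, hr.2.symm⟩
    · exact hr.1.symm.trans (h.trans hr.2.symm)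
    · exact (h3 w).imp hr.1.trans hr.2.symm.trans
  · intro T T' hT hT' h
    rw [← deleteEdges_sup_edge (hadj T hT), ← deleteEdges_sup_edge (hadj T' hT'), h]
  · rintro F ⟨⟨hFG, h1, h2, h3⟩, hu, hv⟩
    have hnr : ¬ F.Reachable u v := fun h ↦ h2 (hu.trans (h.trans hv.symm))
    have hna : ¬ F.Adj u v := fun h ↦ hnr h.reachable
    have htree : (F ⊔ edge u v).IsTree := (isTree_sup_edge_iff F huv.ne hna).2
      ⟨h1, hnr, fun w ↦ (h3 w).imp hu.symm.trans hv.symm.trans⟩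
    refine ⟨F ⊔ edge u v, ⟨⟨sup_le hFG ?_, htree⟩, ?_⟩, sup_edge_deleteEdges hna⟩
    · exact (edge_le_iff _).2 (Or.inr huv)
    · obtain ⟨p, hp, -⟩ := htree.existsUnique_path s t
      -- The path must leave the `F`-component of `s`. No edge of `F` does so, and `v` lies on the
      -- side of `t`, so the exit is `uv` taken from `u` to `v`.
      obtain ⟨d, hd, hd1, hd2⟩ := p.exists_boundary_dart {w | F.Reachable s w}
        (Reachable.refl s) h2
      refine ⟨p, hp, d, hd, ?_⟩
      have hda := d.adj
      rw [sup_adj, edge_adj] at hda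
      rcases hda with hda | ⟨⟨ha, hb⟩ | ⟨ha, hb⟩, -⟩
      · exact absurd (Reachable.trans hd1 hda.reachable) hd2
      · exact Prod.ext ha hb
      · have hd1 : F.Reachable s d.fst := hd1
        exact absurd ((ha ▸ hd1).trans hv.symm) h2

/-- Forests with both `u` and `v` on the side of `s` occur in both counts on the right and cancel.
-/
theorem ncard_spanningTreesThrough_sub [Finite V] (G : SimpleGraph V) {s t u v : V}
    (huv : G.Adj u v) :
    ((G.spanningTreesThrough s t u v).ncard : ℝ) - ((G.spanningTreesThrough s t v u).ncard : ℝ) =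
      ({F ∈ G.separatingForests s t | F.Reachable s u}.ncard : ℝ) -
        ({F ∈ G.separatingForests s t | F.Reachable s v}.ncard : ℝ) := by
  have key : ∀ x y, {F ∈ G.separatingForests s t | F.Reachable s x}.ncard =
      {F ∈ G.separatingForests s t | F.Reachable s x ∧ F.Reachable t y}.ncard +
      {F ∈ G.separatingForests s t | F.Reachable s x ∧ F.Reachable s y}.ncard := by
    intro x y
    rw [← Set.ncard_union_eq _ (Set.toFinite _) (Set.toFinite _)]
    · congr 1
      ext F
      simp only [Set.mem_ofPred_eq, Set.mem_union]
      constructor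
      · rintro ⟨h, hx⟩
        have := h.2.2.2 y
        tauto
      · tauto
    · rw [Set.disjoint_left]
      rintro F ⟨h, -, h1⟩ ⟨-, -, h2⟩
      exact h.2.2.1 (h2.trans h1.symm)
  rw [ncard_spanningTreesThrough G huv, ncard_spanningTreesThrough G huv.symm, key u v, key v u]
  simp_rw [and_comm (a := SimpleGraph.Reachable _ s v) (b := SimpleGraph.Reachable _ s u)]
  push_cast
  ring

/-! ### Unit flows, potentials and energy -/

section Flow

variable [Fintype V] {G : SimpleGraph V} [DecidableRel G.Adj] {s t : V}

theorem sum_dart_symm (f : G.Dart → ℝ) : ∑ d : G.Dart, f d.symm = ∑ d, f d :=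
  Equiv.sum_comp (Function.Involutive.toPerm Dart.symm Dart.symm_involutive) f

theorem flowEnergy_nonneg (θ : G.Dart → ℝ) : 0 ≤ G.flowEnergy θ :=
  mul_nonneg (by norm_num) (Finset.sum_nonneg fun _ _ ↦ sq_nonneg _)

theorem eq_zero_of_flowEnergy_nonpos {θ : G.Dart → ℝ} (h : G.flowEnergy θ ≤ 0) : θ = 0 := by
  have h0 : ∑ d, θ d ^ 2 = 0 :=
    le_antisymm (by unfold flowEnergy at h; linarith) (Finset.sum_nonneg fun _ _ ↦ sq_nonneg _)
  rw [Finset.sum_eq_zero_iff_of_nonneg fun _ _ ↦ sq_nonneg _] at h0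
  exact funext fun d ↦ by simpa using h0 d (Finset.mem_univ d)

variable [DecidableEq V]

theorem sum_dart_snd_eq_neg {θ : G.Dart → ℝ} (h : ∀ d, θ d = -θ d.symm) (u : V) :
    ∑ d : G.Dart with d.snd = u, θ d = -∑ d : G.Dart with d.fst = u, θ d := by
  rw [Finset.sum_filter, Finset.sum_filter, ← sum_dart_symm, ← Finset.sum_neg_distrib]
  refine Finset.sum_congr rfl fun d _ ↦ ?_
  rw [h d]
  change (if d.fst = u then θ d.symm else 0) = -(if d.fst = u then -θ d.symm else 0)
  split_ifs <;> simp

theorem IsUnitFlow.sum_fst {θ : G.Dart → ℝ} (h : G.IsUnitFlow s t θ) (hst : s ≠ t) (u : V) :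
    ∑ d : G.Dart with d.fst = u, θ d = (if u = s then 1 else 0) - (if u = t then 1 else 0) := by
  by_cases hs : u = s
  · subst hs
    simp [h.source, hst]
  by_cases ht : u = t
  · subst ht
    have h1 := h.sink
    rw [sum_dart_snd_eq_neg h.antisymm] at h1
    simp only [hs, if_true, if_false]
    linarith
  · simp [h.conserve u hs ht, hs, ht]

/-- The power identity: pairing a unit flow with the gradient of `φ`. -/
theorem IsUnitFlow.sum_gradient_mul {θ : G.Dart → ℝ} (h : G.IsUnitFlow s t θ) (hst : s ≠ t)
    (φ : V → ℝ) : ∑ d : G.Dart, (φ d.fst - φ d.snd) * θ d = 2 * (φ s - φ t) := by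
  have h1 : ∑ d : G.Dart, φ d.fst * θ d = φ s - φ t := by
    rw [← Finset.sum_fiberwise (s := Finset.univ) (g := fun d : G.Dart ↦ d.fst)]
    have : ∀ u : V, ∑ d : G.Dart with d.fst = u, φ d.fst * θ d =
        φ u * ((if u = s then 1 else 0) - (if u = t then 1 else 0)) := by
      intro u
      rw [← h.sum_fst hst u, Finset.mul_sum]
      refine Finset.sum_congr rfl fun d hd ↦ ?_
      rw [(Finset.mem_filter.1 hd).2]
    simp_rw [this]
    simp [mul_sub, Finset.sum_sub_distrib]
  -- Reversing darts makes the heads contribute as much as the tails, whence the factor 2.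
  have h2 : ∑ d : G.Dart, φ d.snd * θ d = -(φ s - φ t) := by
    rw [← h1, ← sum_dart_symm, ← Finset.sum_neg_distrib]
    refine Finset.sum_congr rfl fun d _ ↦ ?_
    rw [h.antisymm d]
    simp [Dart.symm]
  simp only [sub_mul, Finset.sum_sub_distrib, h1, h2]
  ring

theorem IsUnitFlow.flowEnergy_of_gradient {θ : G.Dart → ℝ} (h : G.IsUnitFlow s t θ) (hst : s ≠ t)
    {φ : V → ℝ} (hφ : ∀ d, θ d = φ d.fst - φ d.snd) : G.flowEnergy θ = φ s - φ t := by
  have := h.sum_gradient_mul hst φ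
  simp only [← hφ, ← pow_two] at this
  rw [flowEnergy, this]
  ring

/-- Pythagoras: by the power identity the gradient `θ` has the same pairing with every unit flow, so
it is orthogonal to `θ' - θ`. -/
theorem IsUnitFlow.flowEnergy_eq_add {θ θ' : G.Dart → ℝ} (h : G.IsUnitFlow s t θ)
    (h' : G.IsUnitFlow s t θ') (hst : s ≠ t) {φ : V → ℝ} (hφ : ∀ d, θ d = φ d.fst - φ d.snd) :
    G.flowEnergy θ' = G.flowEnergy θ + G.flowEnergy (θ' - θ) := by
  have h1 := h.sum_gradient_mul hst φ
  have h2 := h'.sum_gradient_mul hst φ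
  simp only [← hφ] at h1 h2
  have h3 : ∑ d, θ' d ^ 2 = ∑ d, θ d ^ 2 + ∑ d, (θ' - θ) d ^ 2 + 2 * ∑ d, θ d * θ' d
      - 2 * ∑ d, θ d * θ d := by
    simp only [Finset.mul_sum, ← Finset.sum_add_distrib, ← Finset.sum_sub_distrib, Pi.sub_apply]
    exact Finset.sum_congr rfl fun d _ ↦ by ring
  rw [h1, h2] at h3
  simp only [flowEnergy, h3]
  ring

/-- A unit flow satisfying Kirchhoff's cycle law is the unique optimal one. -/
theorem IsUnitFlow.isOptimalFlow_iff {θ θ' : G.Dart → ℝ} (h : G.IsUnitFlow s t θ) (hst : s ≠ t)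
    {φ : V → ℝ} (hφ : ∀ d, θ d = φ d.fst - φ d.snd) : G.IsOptimalFlow s t θ' ↔ θ' = θ := by
  constructor
  · rintro ⟨h', hmin⟩
    have h1 := h.flowEnergy_eq_add h' hst hφ
    have h2 := hmin θ h
    exact sub_eq_zero.1 (eq_zero_of_flowEnergy_nonpos (by linarith))
  · rintro rfl
    refine ⟨h, fun θ'' h'' ↦ ?_⟩
    have h1 := h.flowEnergy_eq_add h'' hst hφ
    linarith [flowEnergy_nonneg (θ'' - θ')]

theorem IsOptimalFlow.toReal_effectiveResistance {θ : G.Dart → ℝ} (h : G.IsOptimalFlow s t θ)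
    (hr : G.Reachable s t) : (G.effectiveResistance s t).toReal = G.flowEnergy θ := by
  have : G.effectiveResistance s t = ENNReal.ofReal (G.flowEnergy θ) := by
    rw [effectiveResistance, if_pos hr]
    exact le_antisymm (iInf₂_le θ h.1)
      (le_iInf₂ fun θ' h' ↦ ENNReal.ofReal_le_ofReal (h.2 θ' h'))
  rw [this, ENNReal.toReal_ofReal (flowEnergy_nonneg θ)]

/-- The net number of times that a walk traverses the darts out of `u`. -/
theorem Walk.sum_count_sub_count {T : SimpleGraph V} (hT : T ≤ G) {a b : V} (p : T.Walk a b)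
    (u : V) :
    ∑ d : G.Dart with d.fst = u, (((p.darts.map (·.toProd)).count d.toProd : ℝ) -
      ((p.darts.map (·.toProd)).count d.toProd.swap : ℝ)) =
      (if u = a then 1 else 0) - (if u = b then 1 else 0) := by
  induction p with
  | nil => simp
  | @cons a c b h p ih =>
    have hac : G.Adj a c := hT h
    -- The new first step adds 1 on the dart `(a, c)` and -1 on its reverse; the boundary terms at
    -- `c` then telescope.
    have h1 : ∀ d : G.Dart, ((((Walk.cons h p).darts.map (·.toProd)).count d.toProd : ℝ) -
        (((Walk.cons h p).darts.map (·.toProd)).count d.toProd.swap : ℝ)) =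
        (((p.darts.map (·.toProd)).count d.toProd : ℝ) -
          ((p.darts.map (·.toProd)).count d.toProd.swap : ℝ)) +
        ((if d = ⟨(a, c), hac⟩ then 1 else 0) - (if d = ⟨(c, a), hac.symm⟩ then 1 else 0)) := by
      intro d
      have e1 : ((a, c) == d.toProd) = decide (d = ⟨(a, c), hac⟩) := by
        rw [Bool.eq_iff_iff, beq_iff_eq, decide_eq_true_iff, Dart.ext_iff]
        exact eq_comm
      have e2 : ((a, c) == d.toProd.swap) = decide (d = ⟨(c, a), hac.symm⟩) := by
        rw [Bool.eq_iff_iff, beq_iff_eq, decide_eq_true_iff, Dart.ext_iff, eq_comm]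
        exact Prod.swap_eq_iff_eq_swap
      simp only [Walk.darts_cons, List.map_cons, List.count_cons, e1, e2, decide_eq_true_eq]
      push_cast
      ring
    simp_rw [h1, Finset.sum_add_distrib, ih, Finset.sum_sub_distrib, Finset.sum_ite_eq']
    simp only [Finset.mem_filter, Finset.mem_univ, true_and, eq_comm (b := u)]
    ring

open Classical in
-- A path repeats no dart, so its dart counts are the membership indicators.
theorem IsTree.sum_mem_spanningTreesThrough {T : SimpleGraph V} (hT : T ∈ G.spanningTrees)
    (s t u : V) :
    ∑ d : G.Dart with d.fst = u,
      ((if T ∈ G.spanningTreesThrough s t d.fst d.snd then (1 : ℝ) else 0) -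
        (if T ∈ G.spanningTreesThrough s t d.snd d.fst then 1 else 0)) =
      (if u = s then 1 else 0) - (if u = t then 1 else 0) := by
  obtain ⟨p, hp, hu⟩ := hT.2.existsUnique_path s t
  have key : ∀ x y, (if T ∈ G.spanningTreesThrough s t x y then (1 : ℝ) else 0) =
      ((p.darts.map (·.toProd)).count (x, y) : ℝ) := by
    intro x y
    have hnd : (p.darts.map (·.toProd)).Nodup :=
      List.Nodup.map (fun d d' h ↦ Dart.ext _ _ h) (Walk.darts_nodup_of_support_nodup hp.support_nodup)
    have hiff : T ∈ G.spanningTreesThrough s t x y ↔ (x, y) ∈ p.darts.map (·.toProd) := by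
      rw [List.mem_map]
      constructor
      · rintro ⟨-, q, hq, h⟩
        rw [hu q hq] at h
        exact h
      · exact fun h ↦ ⟨hT, p, hp, h⟩
    rw [List.Nodup.count hnd]
    simp [hiff]
  simp_rw [key]
  exact p.sum_count_sub_count hT.1 u

theorem isUnitFlow_of_spanningTrees (hG : G.Connected) (hst : s ≠ t) :
    G.IsUnitFlow s t fun d ↦ (((G.spanningTreesThrough s t d.fst d.snd).ncard : ℝ) -
      ((G.spanningTreesThrough s t d.snd d.fst).ncard : ℝ)) / (G.spanningTrees.ncard : ℝ) := by
  classical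
  set θ : G.Dart → ℝ := fun d ↦ (((G.spanningTreesThrough s t d.fst d.snd).ncard : ℝ) -
      ((G.spanningTreesThrough s t d.snd d.fst).ncard : ℝ)) / (G.spanningTrees.ncard : ℝ) with hθ
  have hpos : (G.spanningTrees.ncard : ℝ) ≠ 0 := by
    obtain ⟨T, hT⟩ := hG.exists_isTree_le
    exact_mod_cast Set.ncard_ne_zero_of_mem (show T ∈ G.spanningTrees from hT) (Set.toFinite _)
  have hanti : ∀ d, θ d = -θ d.symm := by
    intro d
    simp only [hθ, Dart.symm, Prod.fst_swap, Prod.snd_swap]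
    ring
  have hcount : ∀ x y, ((G.spanningTreesThrough s t x y).ncard : ℝ) =
      ∑ T ∈ G.spanningTrees.toFinset, if T ∈ G.spanningTreesThrough s t x y then 1 else 0 := by
    intro x y
    rw [Finset.sum_boole, Set.ncard_eq_toFinset_card']
    congr 2
    ext T
    simp only [Set.mem_toFinset, Finset.mem_filter]
    exact ⟨fun h ↦ ⟨h.1, h⟩, fun h ↦ h.2⟩
  have hsum : ∀ u, ∑ d : G.Dart with d.fst = u, θ d =
      (if u = s then 1 else 0) - (if u = t then 1 else 0) := by
    intro u
    simp only [hθ, hcount, ← Finset.sum_div, ← Finset.sum_sub_distrib]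
    rw [Finset.sum_comm, Finset.sum_congr rfl fun T hT ↦
      IsTree.sum_mem_spanningTreesThrough (Set.mem_toFinset.1 hT) s t u, Finset.sum_const,
      ← Set.ncard_eq_toFinset_card', nsmul_eq_mul, mul_div_cancel_left₀ _ hpos]
  refine ⟨hanti, by simp [hsum, hst], ?_, fun u hs ht ↦ by simp [hsum, hs, ht]⟩
  rw [sum_dart_snd_eq_neg hanti, hsum]
  simp [hst.symm]

end Flow

/-! ### Spanning trees of the contraction -/

section Contract

open Classical in
/-- The vertex map that identifies `t` with `s`. -/
noncomputable def identify (s t z : V) : V := if z = t then s else z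

theorem identify_ne {s t : V} (hst : s ≠ t) (z : V) : identify s t z ≠ t := by
  unfold identify; split_ifs <;> assumption

theorem identify_of_ne {s t z : V} (h : z ≠ t) : identify s t z = z := if_neg h

theorem identify_right (s t : V) : identify s t t = s := if_pos rfl

variable {G F : SimpleGraph V} {s t : V}

theorem mem_vertexSet_addEdgeContract (hst : s ≠ t) (x : V) :
    x ∈ (G.addEdgeContract hst).vertexSet ↔ x ≠ t := by
  change x ∈ identify s t '' Set.univ ↔ _
  constructor
  · rintro ⟨z, -, rfl⟩
    exact identify_ne hst z
  · exact fun h ↦ ⟨x, trivial, identify_of_ne h⟩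

theorem edgeSet_addEdgeContract (hst : s ≠ t) (hadj : ¬ G.Adj s t) :
    (G.addEdgeContract hst).edgeSet = G.edgeSet := by
  change (G ⊔ edge s t).edgeSet \ {s(s, t)} = G.edgeSet
  rw [← edgeSet_deleteEdges, sup_edge_deleteEdges hadj]

/-- The spanning subgraph of the contraction with the edges of `F`. -/
noncomputable def contractForest (G : SimpleGraph V) (hst : s ≠ t) (F : SimpleGraph V) :
    Graph V (Sym2 V) :=
  (G.addEdgeContract hst).restrict F.edgeSet

theorem contractForest_isLink (hst : s ≠ t) (hadj : ¬ G.Adj s t) (hF : F ≤ G) (e : Sym2 V)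
    (x y : V) : (contractForest G hst F).IsLink e x y ↔
      ∃ a b, e = s(a, b) ∧ F.Adj a b ∧ identify s t a = x ∧ identify s t b = y := by
  change (e ∈ F.edgeSet ∧ Relation.Map (fun a b ↦ (e = s(a, b) ∧ e ∈ (G ⊔ edge s t).edgeSet) ∧
    e ∉ ({s(s, t)} : Set (Sym2 V))) (identify s t) (identify s t) x y) ↔ _
  constructor
  · rintro ⟨he, a, b, ⟨⟨rfl, -⟩, -⟩, h1, h2⟩
    exact ⟨a, b, rfl, he, h1, h2⟩
  · rintro ⟨a, b, rfl, he, h1, h2⟩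
    have hG : s(a, b) ∈ G.edgeSet := hF he
    refine ⟨he, a, b, ⟨⟨rfl, edgeSet_mono le_sup_left hG⟩, fun h ↦ hadj ?_⟩, h1, h2⟩
    rw [Set.mem_singleton_iff.1 h] at hG
    exact hG

/-- A loop would come from an edge `st`, and a parallel pair from a common neighbour of `s` and `t`;
either would join `s` to `t` in `F`. -/
theorem contractForest_simple (hst : s ≠ t) (hadj : ¬ G.Adj s t)
    (hF : F ∈ G.separatingForests s t) : (contractForest G hst F).Simple := by
  have hr := hF.2.2.1
  have hna : ∀ a b, F.Adj a b → ¬ (a = s ∧ b = t) ∧ ¬ (a = t ∧ b = s) := fun a b h ↦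
    ⟨by rintro ⟨rfl, rfl⟩; exact hr h.reachable, by rintro ⟨rfl, rfl⟩; exact hr h.symm.reachable⟩
  have hnc : ∀ b, F.Adj s b → ¬ F.Adj t b := fun b h h' ↦
    hr (h.reachable.trans h'.symm.reachable)
  refine { not_isLoopAt := ?_, eq_of_isLink := ?_ }
  · intro e x h
    rw [Graph.IsLoopAt, contractForest_isLink hst hadj hF.1] at h
    obtain ⟨a, b, -, hab, h1, h2⟩ := h
    have := hab.ne
    have := hna a b hab
    unfold identify at h1 h2
    grind
  · intro e f x y he hf
    rw [contractForest_isLink hst hadj hF.1] at he hf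
    obtain ⟨a, b, rfl, hab, h1, h2⟩ := he
    obtain ⟨a', b', rfl, hab', h1', h2'⟩ := hf
    have n1 := hna a b hab
    have n2 := hna a' b' hab'
    have c1 := hnc b
    have c2 := hnc b'
    have c3 := hnc a
    have c4 := hnc a'
    have i1 := hab.symm
    have l1 := hab.ne
    have l2 := hab'.ne
    have i2 := hab'.symm
    unfold identify at h1 h2 h1' h2'
    have : a = a' ∧ b = b' := by grind
    rw [this.1, this.2]

/-- The quotient map from the vertices of `G` to those of its contraction. -/
noncomputable def contractVert (G F : SimpleGraph V) (hst : s ≠ t) (z : V) :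
    (contractForest G hst F).vertexSet :=
  ⟨identify s t z, (mem_vertexSet_addEdgeContract hst _).2 (identify_ne hst z)⟩

theorem contractForest_adj (hst : s ≠ t) (hadj : ¬ G.Adj s t) (hF : F ≤ G)
    (hS : (contractForest G hst F).Simple) {a b : V} (hab : F.Adj a b) :
    (contractForest G hst F).toSimpleGraph.Adj (contractVert G F hst a)
      (contractVert G F hst b) := by
  have hl : (contractForest G hst F).IsLink s(a, b) (identify s t a) (identify s t b) :=
    (contractForest_isLink hst hadj hF _ _ _).2 ⟨a, b, rfl, hab, rfl, rfl⟩
  exact ⟨fun h ↦ hl.ne (congrArg Subtype.val h), _, hl⟩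

theorem exists_adj_of_contractForest_adj (hst : s ≠ t) (hadj : ¬ G.Adj s t) (hF : F ≤ G)
    {x y : (contractForest G hst F).vertexSet}
    (h : (contractForest G hst F).toSimpleGraph.Adj x y) :
    ∃ a b, F.Adj a b ∧ contractVert G F hst a = x ∧ contractVert G F hst b = y := by
  obtain ⟨-, e, he⟩ := h
  obtain ⟨a, b, -, hab, h1, h2⟩ := (contractForest_isLink hst hadj hF _ _ _).1 he
  exact ⟨a, b, hab, Subtype.ext h1, Subtype.ext h2⟩

theorem ncard_edgeSet_contractForest (hst : s ≠ t) (hadj : ¬ G.Adj s t) (hF : F ≤ G)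
    (hS : (contractForest G hst F).Simple) :
    (contractForest G hst F).toSimpleGraph.edgeSet.ncard = F.edgeSet.ncard := by
  refine (Set.ncard_congr (fun e _ ↦ e.map (contractVert G F hst)) ?_ ?_ ?_).symm
  · rintro ⟨a, b⟩ he
    exact contractForest_adj hst hadj hF hS he
  · rintro ⟨a, b⟩ ⟨a', b'⟩ he he' h
    have hl : ∀ x y, F.Adj x y →
        (contractForest G hst F).IsLink s(x, y) (identify s t x) (identify s t y) :=
      fun x y h ↦ (contractForest_isLink hst hadj hF _ _ _).2 ⟨x, y, rfl, h, rfl, rfl⟩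
    have h1 := hl a b he
    have h2 := hl a' b' he'
    rcases Sym2.eq_iff.1 h with ⟨h3, h4⟩ | ⟨h3, h4⟩
    · have h3 : identify s t a = identify s t a' := congrArg Subtype.val h3
      have h4 : identify s t b = identify s t b' := congrArg Subtype.val h4
      rw [h3, h4] at h1
      exact h1.eq h2
    · have h3 : identify s t a = identify s t b' := congrArg Subtype.val h3
      have h4 : identify s t b = identify s t a' := congrArg Subtype.val h4
      rw [h3, h4] at h1
      exact h1.eq h2.symm
  · rintro ⟨x, y⟩ he
    obtain ⟨a, b, hab, rfl, rfl⟩ := exists_adj_of_contractForest_adj hst hadj hF he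
    exact ⟨s(a, b), hab, rfl⟩

theorem contractForest_connected (hst : s ≠ t) (hadj : ¬ G.Adj s t) (hF : F ≤ G)
    (hS : (contractForest G hst F).Simple) :
    (contractForest G hst F).toSimpleGraph.Connected ↔
      ∀ w, F.Reachable s w ∨ F.Reachable t w := by
  have hts : contractVert G F hst t = contractVert G F hst s :=
    Subtype.ext ((identify_right s t).trans (identify_of_ne hst).symm)
  have hsurj : ∀ x : (contractForest G hst F).vertexSet, contractVert G F hst x.1 = x := fun x ↦
    Subtype.ext (identify_of_ne ((mem_vertexSet_addEdgeContract hst _).1 x.2))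
  constructor
  · intro h w
    -- Being reached from `s` or `t` is unaffected by the identification, so it propagates along
    -- walks in the quotient.
    have hid : ∀ z, (F.Reachable s (identify s t z) ∨ F.Reachable t (identify s t z)) ↔
        (F.Reachable s z ∨ F.Reachable t z) := by
      intro z
      by_cases hz : z = t
      · subst hz
        simp [identify_right]
      · rw [identify_of_ne hz]
    obtain ⟨p⟩ := h.preconnected (contractVert G F hst s) (contractVert G F hst w)
    let S : Set (contractForest G hst F).vertexSet := {x | F.Reachable s x.1 ∨ F.Reachable t x.1}
    have hs : contractVert G F hst s ∈ S := (hid s).2 (Or.inl (Reachable.refl s))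
    refine (hid w).1 (p.mem_of_forall_adj (S := S) ?_ hs)
    intro x y hxy hx
    obtain ⟨a, b, hab, rfl, rfl⟩ := exists_adj_of_contractForest_adj hst hadj hF hxy
    refine (hid b).2 (((hid a).1 hx).imp ?_ ?_) <;> exact (·.trans hab.reachable)
  · intro h
    let f : F →g (contractForest G hst F).toSimpleGraph :=
      ⟨contractVert G F hst, fun hab ↦ contractForest_adj hst hadj hF hS hab⟩
    have key : ∀ x, (contractForest G hst F).toSimpleGraph.Reachable (contractVert G F hst s) x := by
      intro x
      rw [← hsurj x]
      rcases h x.1 with h | h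
      · exact h.map f
      · rw [← hts]
        exact h.map f
    have : Nonempty (contractForest G hst F).vertexSet := ⟨contractVert G F hst s⟩
    exact ⟨fun x y ↦ (key x).symm.trans (key y)⟩

theorem card_vertexSet_contractForest [Finite V] (hst : s ≠ t) :
    Nat.card (contractForest G hst F).vertexSet + 1 = Nat.card V := by
  have : (contractForest G hst F).vertexSet = ({t} : Set V)ᶜ :=
    Set.ext fun x ↦ mem_vertexSet_addEdgeContract hst x
  rw [this, Nat.card_coe_set_eq, ← Set.ncard_add_ncard_compl ({t} : Set V), Set.ncard_singleton,
    add_comm]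

/-- Both sides reduce to connectedness plus an edge count: the contraction has one vertex fewer than
`G`, and `F` one edge fewer than the tree `F ⊔ edge s t`. -/
theorem contractForest_isTree_iff [Finite V] (hst : s ≠ t) (hadj : ¬ G.Adj s t) (hF : F ≤ G) :
    (contractForest G hst F).IsTree ↔ F ∈ G.separatingForests s t := by
  have hFadj : ¬ F.Adj s t := fun h ↦ hadj (hF h)
  have hcard := card_vertexSet_contractForest (G := G) (F := F) hst
  have hmem : F ∈ G.separatingForests s t ↔ (∀ w, F.Reachable s w ∨ F.Reachable t w) ∧
      F.edgeSet.ncard + 1 + 1 = Nat.card V := by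
    have h1 : F ∈ G.separatingForests s t ↔ (F ⊔ edge s t).IsTree := by
      rw [isTree_sup_edge_iff F hst hFadj]
      exact and_iff_right hF
    have h2 : (F ⊔ edge s t).edgeSet.ncard = F.edgeSet.ncard + 1 := by
      rw [edgeSet_sup, edgeSet_edge_of_ne hst, Set.union_singleton,
        Set.ncard_insert_of_notMem (a := s(s, t)) hFadj (Set.toFinite _)]
    rw [h1, isTree_iff_connected_and_card, connected_sup_edge_iff F hst, Nat.card_coe_set_eq, h2]
  have key : (contractForest G hst F).Simple →
      ((contractForest G hst F).toSimpleGraph.IsTree ↔ F ∈ G.separatingForests s t) := by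
    intro hS
    rw [isTree_iff_connected_and_card, contractForest_connected hst hadj hF hS,
      Nat.card_coe_set_eq, ncard_edgeSet_contractForest hst hadj hF hS, hmem, ← hcard,
      Nat.add_right_cancel_iff]
  refine ⟨fun h ↦ (key h.1).1 h.2, fun h ↦ ?_⟩
  have hS := contractForest_simple hst hadj h
  exact ⟨hS, (key hS).2 h⟩

theorem ncard_spanningTrees_addEdgeContract [Finite V] (hst : s ≠ t) (hadj : ¬ G.Adj s t) :
    (G.addEdgeContract hst).spanningTrees.ncard = (G.separatingForests s t).ncard := by
  have hE := edgeSet_addEdgeContract hst hadj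
  have hcE : ∀ F ≤ G, (contractForest G hst F).edgeSet = F.edgeSet := fun F hF ↦ by
    change (G.addEdgeContract hst).edgeSet ∩ F.edgeSet = _
    rw [hE, Set.inter_eq_right]
    exact edgeSet_mono hF
  refine (Set.ncard_congr (fun F _ ↦ contractForest G hst F) ?_ ?_ ?_).symm
  · exact fun F hF ↦ ⟨⟨Graph.restrict_le, rfl⟩, (contractForest_isTree_iff hst hadj hF.1).2 hF⟩
  · intro F F' hF hF' h
    rw [← edgeSet_inj, ← hcE F hF.1, ← hcE F' hF'.1, h]
  · rintro T ⟨hT, htree⟩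
    have hsub : T.edgeSet ⊆ G.edgeSet := hE ▸ hT.le.edgeSet_mono
    -- `fromEdgeSet` drops diagonal pairs, but edges keep their labels from `G`, so none is
    -- diagonal.
    have hes : (fromEdgeSet T.edgeSet).edgeSet = T.edgeSet := by
      rw [edgeSet_fromEdgeSet, sdiff_eq_left, Set.disjoint_left]
      exact fun e he ↦ G.not_isDiag_of_mem_edgeSet (hsub he)
    have hle : fromEdgeSet T.edgeSet ≤ G := by
      rw [← edgeSet_subset_edgeSet, hes]
      exact hsub
    have hTe : contractForest G hst (fromEdgeSet T.edgeSet) = T := by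
      refine Graph.Compatible.ext hT.vertexSet_eq.symm ((hcE _ hle).trans hes)
        (Graph.Compatible.of_le_le Graph.restrict_le hT.le)
    refine ⟨fromEdgeSet T.edgeSet, ?_, hTe⟩
    rw [← contractForest_isTree_iff hst hadj hle, hTe]
    exact htree

end Contract

end SimpleGraph

/-! ### Effective resistance as a ratio of counts -/

theorem mainTheorem10 {V : Type*} [Fintype V] [DecidableEq V] (G : SimpleGraph V)
    [DecidableRel G.Adj] (hG : G.Connected) (s t : V) (hst : s ≠ t) (hadj : ¬ G.Adj s t) :
    (∃! θ : G.Dart → ℝ, G.IsOptimalFlow s t θ) ∧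
    ∀ θ : G.Dart → ℝ, G.IsOptimalFlow s t θ → ∀ (u v : V) (huv : G.Adj u v),
      G.edgeProb s t θ ⟨(u, v), huv⟩ =
        (((G.spanningTreesThrough s t u v).ncard : ℝ) -
            ((G.spanningTreesThrough s t v u).ncard : ℝ)) ^ 2 /
          ((G.spanningTrees.ncard : ℝ) * ((G.addEdgeContract hst).spanningTrees.ncard : ℝ)) := by
  have hflow := SimpleGraph.isUnitFlow_of_spanningTrees hG hst
  set θ₀ : G.Dart → ℝ := fun d ↦ (((G.spanningTreesThrough s t d.fst d.snd).ncard : ℝ) -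
      ((G.spanningTreesThrough s t d.snd d.fst).ncard : ℝ)) / (G.spanningTrees.ncard : ℝ) with hθ₀
  let φ : V → ℝ := fun u ↦
    ({F ∈ G.separatingForests s t | F.Reachable s u}.ncard : ℝ) / (G.spanningTrees.ncard : ℝ)
  have hφ : ∀ d, θ₀ d = φ d.fst - φ d.snd := fun d ↦ by
    simp only [hθ₀, φ]
    rw [SimpleGraph.ncard_spanningTreesThrough_sub G d.adj, sub_div]
  have hopt : ∀ θ, G.IsOptimalFlow s t θ ↔ θ = θ₀ := fun θ ↦ hflow.isOptimalFlow_iff hst hφ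
  refine ⟨⟨θ₀, (hopt θ₀).2 rfl, fun θ h ↦ (hopt θ).1 h⟩, fun θ hθ u v huv ↦ ?_⟩
  have hs : {F ∈ G.separatingForests s t | F.Reachable s s} = G.separatingForests s t :=
    Set.sep_eq_self_iff_mem_true.2 fun F _ ↦ SimpleGraph.Reachable.refl s
  have ht : {F ∈ G.separatingForests s t | F.Reachable s t} = ∅ :=
    Set.sep_eq_empty_iff_mem_false.2 fun F hF ↦ hF.2.2.1
  have hT : (G.spanningTrees.ncard : ℝ) ≠ 0 := by
    obtain ⟨T, hT⟩ := hG.exists_isTree_le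
    exact_mod_cast Set.ncard_ne_zero_of_mem (show T ∈ G.spanningTrees from hT) (Set.toFinite _)
  rw [SimpleGraph.edgeProb, hθ.toReal_effectiveResistance (hG.preconnected s t), (hopt θ).1 hθ,
    hflow.flowEnergy_of_gradient hst hφ, SimpleGraph.ncard_spanningTrees_addEdgeContract hst hadj]
  simp only [hθ₀, φ, hs, ht, Set.ncard_empty, Nat.cast_zero, zero_div, sub_zero]
  -- With no separating forests both sides would be divisions by zero, equal to 0, so positivity of
  -- the count is not needed.
  by_cases hF : ((G.separatingForests s t).ncard : ℝ) = 0
  · simp [hF]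
  · field_simp
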